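/- For $k\ge 1$ let $D_k=(d_{ij})_{1\le i,j\le k}$ be the complex symmetric matrix $D_k=E_k+\sqrt{-1}\,F_k$, where $E_k$ has entry $1$ at the positions with $|i-j|=1$ and $0$ elsewhere, and $F_k$ has entry $1$ at the positions with $i+j=k$, entry $-1$ at the positions with $i+j=k+2$, and $0$ elsewhere. Let $O(n,\mathbb{C})=\{T\in M_n(\mathbb{C}): TT^{\mathsf T}=I_n\}$ and $SO(n,\mathbb{C})=\{T\in O(n,\mathbb{C}):\det T=1\}$. The elementary divisors of $A\in M_n(\mathbb{C})$ are polynomials $(X-\lambda_1)^{k_1},\dots,(X-\lambda_t)^{k_t}$ with all $k_i\ge 1$ such that $\mathbb{C}^n$, as the $\mathbb{C}[X]$-module on which $X$ acts as $A$, is isomorphic to $\bigoplus_{i=1}^t\mathbb{C}[X]/((X-\lambda_i)^{k_i})$. **Proposition.** 1. Let $A$ be a complex symmetric $n\times n$ matrix. Then $A$ has elementary divisors in this sense, and whenever $(X-\lambda_1)^{k_1},\dots,(X-\lambda_t)^{k_t}$ are the elementary divisors of $A$ (listed with multiplicity, in any order), one has $k_1+\dots+k_t=n$ and there is $T\in O(n,\mathbb{C})$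 such that $$TAT^{-1}=\mathrm{diag}(\lambda_1I_{k_1}+D_{k_1},\dots,\lambda_tI_{k_t}+D_{k_t}).$$ 2. If $n$ is odd, then $T$ in part 1 can be chosen in $SO(n,\mathbb{C})$. 3. Let $A$ be a complex symmetric $3\times3$ matrix of rank $r(A)$. Then there are $T\in SO(3,\mathbb{C})$ and a matrix $P$ in the list below for the rank $r(A)$ such that $P=TAT^{-1}$. Moreover $P$ is unique up to the order of the entries of a diagonal matrix: if a matrix $Q$ in the list for some rank $r$ also has the form $Q=SAS^{-1}$ with $S\in SO(3,\mathbb{C})$, then $r=r(A)$, and either $Q=P$, or $P$ and $Q$ are both diagonal and their diagonal entries differ only by a permutation. In the list, $\lambda,\lambda_1,\lambda_2,\lambda_3$ are arbitrary non-zero complex numbers. - Rank $3$: $$\begin{pmatrix}\lambda_1&0&0\\0&\lambda_2&0\\0&0&\lambda_3\end{pmatrix},\quad \begin{pmatrix}\lambda_1&0&0\\0&\lambda_2+\sqrt{-1}&1\\0&1&\lambda_2-\sqrt{-1}\end{pmatrix},\quad \begin{pmatrix}\lambda&1+\sqrt{-1}&0\\1+\sqrt{-1}&\lambda&1-\sqrt{-1}\\0&1-\sqrt{-1}&\lambda\end{pmatrix}.$$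 - Rank $2$: $$\begin{pmatrix}\lambda_1&0&0\\0&\lambda_2&0\\0&0&0\end{pmatrix},\quad \begin{pmatrix}\lambda+\sqrt{-1}&1&0\\1&\lambda-\sqrt{-1}&0\\0&0&0\end{pmatrix},\quad \begin{pmatrix}\lambda&0&0\\0&\sqrt{-1}&1\\0&1&-\sqrt{-1}\end{pmatrix},\quad \begin{pmatrix}0&1+\sqrt{-1}&0\\1+\sqrt{-1}&0&1-\sqrt{-1}\\0&1-\sqrt{-1}&0\end{pmatrix}.$$ - Rank $1$: $$\begin{pmatrix}\lambda&0&0\\0&0&0\\0&0&0\end{pmatrix},\quad \begin{pmatrix}\sqrt{-1}&1&0\\1&-\sqrt{-1}&0\\0&0&0\end{pmatrix}.$$ - Rank $0$: the zero matrix. -/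

import Mathlib

open scoped Polynomial DirectSum

/-- The `k × k` complex symmetric matrix `D_k`.  With rows and columns numbered from `1`, its
real part has entry `1` where `|i - j| = 1`, and its imaginary part has entry `1` where
`i + j = k` and entry `-1` where `i + j = k + 2`.  (In the code, indices start from `0`.) -/
noncomputable def symBlock (k : ℕ) : Matrix (Fin k) (Fin k) ℂ :=
  Matrix.of fun i j =>
    (if (i : ℕ) + 1 = j ∨ (j : ℕ) + 1 = i then 1 else 0) +
      Complex.I * ((if (i : ℕ) + j + 2 = k then 1 else 0) - (if (i : ℕ) + j = k then 1 else 0))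

/-- The elementary divisors of the matrix `A` are `(X - l 0) ^ k 0, …, (X - l (t - 1)) ^ k (t - 1)`
(with multiplicities): all exponents are positive, and the `ℂ[X]`-module `ℂⁿ`, on which `X` acts
as `A`, is isomorphic to the direct sum of the modules `ℂ[X] / ((X - l i) ^ k i)`. -/
def HasElementaryDivisors {n t : ℕ} (A : Matrix (Fin n) (Fin n) ℂ)
    (l : Fin t → ℂ) (k : Fin t → ℕ) : Prop :=
  (∀ i, 0 < k i) ∧
    Nonempty (Module.AEval' (Matrix.toLin' A) ≃ₗ[ℂ[X]]
      ⨁ i : Fin t, ℂ[X] ⧸ Ideal.span {(Polynomial.X - Polynomial.C (l i)) ^ k i})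

/-- The block-diagonal matrix `diag(l 0 • I + D_{k 0}, …, l (t - 1) • I + D_{k (t - 1)})`, with the
blocks in this order, as a matrix of size `n = k 0 + … + k (t - 1)`. -/
noncomputable def symNormalForm {n t : ℕ} (l : Fin t → ℂ) (k : Fin t → ℕ)
    (h : ∑ i, k i = n) : Matrix (Fin n) (Fin n) ℂ :=
  Matrix.reindex (finSigmaFinEquiv.trans (finCongr h)) (finSigmaFinEquiv.trans (finCongr h))
    (Matrix.blockDiagonal' fun i => l i • (1 : Matrix (Fin (k i)) (Fin (k i)) ℂ) + symBlock (k i))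

/-- `IsNormalForm3 r P`: the matrix `P` is in the list of `3 × 3` normal forms of rank `r`. -/
inductive IsNormalForm3 : ℕ → Matrix (Fin 3) (Fin 3) ℂ → Prop
  | rank3_diag {a b c : ℂ} (ha : a ≠ 0) (hb : b ≠ 0) (hc : c ≠ 0) :
      IsNormalForm3 3 !![a, 0, 0; 0, b, 0; 0, 0, c]
  | rank3_two {a b : ℂ} (ha : a ≠ 0) (hb : b ≠ 0) :
      IsNormalForm3 3 !![a, 0, 0; 0, b + Complex.I, 1; 0, 1, b - Complex.I]
  | rank3_three {a : ℂ} (ha : a ≠ 0) :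
      IsNormalForm3 3 !![a, 1 + Complex.I, 0;
                         1 + Complex.I, a, 1 - Complex.I;
                         0, 1 - Complex.I, a]
  | rank2_diag {a b : ℂ} (ha : a ≠ 0) (hb : b ≠ 0) :
      IsNormalForm3 2 !![a, 0, 0; 0, b, 0; 0, 0, 0]
  | rank2_two {a : ℂ} (ha : a ≠ 0) :
      IsNormalForm3 2 !![a + Complex.I, 1, 0; 1, a - Complex.I, 0; 0, 0, 0]
  | rank2_two_zero {a : ℂ} (ha : a ≠ 0) :
      IsNormalForm3 2 !![a, 0, 0; 0, Complex.I, 1; 0, 1, -Complex.I]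
  | rank2_three :
      IsNormalForm3 2 !![0, 1 + Complex.I, 0;
                         1 + Complex.I, 0, 1 - Complex.I;
                         0, 1 - Complex.I, 0]
  | rank1_diag {a : ℂ} (ha : a ≠ 0) :
      IsNormalForm3 1 !![a, 0, 0; 0, 0, 0; 0, 0, 0]
  | rank1_two :
      IsNormalForm3 1 !![Complex.I, 1, 0; 1, -Complex.I, 0; 0, 0, 0]
  | rank0 :
      IsNormalForm3 0 !![0, 0, 0; 0, 0, 0; 0, 0, 0]

/-- `P` and `Q` are equal, or they are diagonal matrices whose diagonal entries differ only in
their order. -/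
def EqUpToDiagonalOrder (P Q : Matrix (Fin 3) (Fin 3) ℂ) : Prop :=
  P = Q ∨ ∃ (d : Fin 3 → ℂ) (σ : Equiv.Perm (Fin 3)),
    P = Matrix.diagonal d ∧ Q = Matrix.diagonal (d ∘ σ)

/-! Similar complex symmetric matrices are already conjugate by a complex orthogonal matrix
(`Matrix.IsSymm.exists_orthogonal_conj`), so everything reduces to similarity. If `S * A = B * S`,
transposing shows that `Sᵀ * S` commutes with `A`. A square root `Q` of `Sᵀ * S` that is a
polynomial in it is symmetric and commutes with `A`; hence `S * Q⁻¹` is orthogonal and still carries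
`A` to `B`. Such a root exists because `X` is a square modulo any polynomial not vanishing at `0`.

It remains to find a symmetric matrix in each similarity class. The structure theorem over `ℂ[X]`
supplies Jordan blocks, and `exists_symBlock_mul_eq` makes each nilpotent block, scaled by 2,
similar to `symBlock`. In odd dimension the sign of `T` adjusts its determinant.

For `3 × 3` matrices, existence runs through the possible block sizes. Uniqueness needs only
similarity: the characteristic polynomial fixes the eigenvalues, and the vanishing of powers of `P -
x • 1` separates the Jordan types. -/

/-! ### Square roots of `X` modulo a polynomial. -/

open Polynomial in
/-- A complex polynomial not vanishing at `0` has a square root of `X` modulo it. -/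
theorem exists_dvd_sq_sub_X (m : ℂ[X]) (hm : m.eval 0 ≠ 0) : ∃ p : ℂ[X], m ∣ p ^ 2 - X := by
  have hm0 : m ≠ 0 := by rintro rfl; simp at hm
  choose r hr using fun z : ℂ => IsAlgClosed.exists_pow_nat_eq z (n := 2) two_pos
  set q : ℂ[X] := Lagrange.interpolate m.roots.toFinset id r with hq
  have hqr : ∀ z, m.eval z = 0 → q.eval z ^ 2 = z := fun z hz => by
    have := Lagrange.eval_interpolate_at_node (s := m.roots.toFinset) (v := id) r
      (Function.injective_id.injOn) (i := z) (by simp [hm0, hz])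
    simp only [id] at this
    rw [hq, this, hr]
  -- `q ^ 2 - X` vanishes at every root of `m`, and no root has multiplicity above `m.natDegree`. So
  -- `q` is a square root of `X` up to a nilpotent.
  have hdvd : m ∣ (q ^ 2 - X) ^ m.natDegree := by
    rcases eq_or_ne (q ^ 2 - X) 0 with h0 | h0
    · rcases Nat.eq_zero_or_pos m.natDegree with h | h
      · rw [h, pow_zero]
        rw [eq_C_of_natDegree_eq_zero h] at hm ⊢
        exact (isUnit_C.mpr (by simpa using hm)).dvd
      · rw [h0, zero_pow h.ne']; exact dvd_zero _
    · rw [IsAlgClosed.dvd_iff_roots_le_roots hm0 (pow_ne_zero _ h0), roots_pow,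
        Multiset.le_iff_count]
      intro z
      rw [Multiset.count_nsmul]
      by_cases hz : z ∈ m.roots
      · have h1 : 1 ≤ (q ^ 2 - X).roots.count z := by
          rw [Multiset.one_le_count_iff_mem, mem_roots h0]
          simp [hqr z ((mem_roots hm0).mp hz)]
        calc m.roots.count z ≤ m.roots.card := Multiset.count_le_card _ _
          _ ≤ m.natDegree := card_roots' m
          _ ≤ _ := Nat.le_mul_of_pos_right _ h1
      · simp [Multiset.count_eq_zero_of_notMem hz]
  -- A common root `z` would satisfy `z = q(z) ^ 2 = 0`, but `m` does not vanish at `0`.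
  have hcop : IsCoprime q m := by
    rw [isCoprime_iff_aeval_ne_zero_of_isAlgClosed ℂ ℂ]
    intro z
    by_contra! h
    simp only [coe_aeval_eq_eval] at h
    have := hqr z h.2
    rw [h.1] at this
    have : z = 0 := by rw [← this]; simp
    subst this
    exact hm h.2
  let φ := Ideal.Quotient.mk (Ideal.span {m})
  have hφ : ∀ f, φ f = 0 ↔ m ∣ f := fun f => by
    rw [Ideal.Quotient.eq_zero_iff_mem, Ideal.mem_span_singleton]
  let P : ℂ[X][X] := X ^ 2 - C X
  have hP : ∀ f, aeval (φ f) P = φ (f ^ 2 - X) := fun f => by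
    simp only [P, map_sub, map_pow, aeval_X, aeval_C]
    rfl
  have h1 : IsNilpotent (aeval (φ q) P) := ⟨m.natDegree, by rw [hP, ← map_pow, hφ]; exact hdvd⟩
  have h2 : IsUnit (aeval (φ q) (derivative P)) := by
    have e2 : aeval (φ q) (derivative P) = φ (C 2 * q) := by
      rw [show C 2 * q = q + q by rw [map_ofNat]; ring]
      simp [P, one_add_one_eq_two]
      rw [map_ofNat, two_mul]
    rw [e2, map_mul]
    refine IsUnit.mul ?_ ?_
    · exact (isUnit_C.mpr (isUnit_iff_ne_zero.mpr two_ne_zero)).map φ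
    · obtain ⟨a, b, hab⟩ := hcop
      refine IsUnit.of_mul_eq_one (φ a) ?_
      rw [← map_mul, ← map_one φ, ← sub_eq_zero, ← map_sub, hφ, ← hab]
      exact ⟨-b, by ring⟩
  -- Newton iteration: the approximate root `q` of `P` lifts to an exact one, since the derivative
  -- `2 * q` is a unit modulo `m`.
  obtain ⟨y, ⟨-, hy⟩, -⟩ := existsUnique_nilpotent_sub_and_aeval_eq_zero h1 h2
  obtain ⟨p, rfl⟩ := Ideal.Quotient.mk_surjective y
  exact ⟨p, by rw [← hφ, ← hP]; exact hy⟩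

/-! ### From similarity to orthogonal conjugacy. -/

namespace Matrix

variable {n : Type*} [Fintype n] [DecidableEq n]

/-- An invertible complex matrix has a square root which is a polynomial in it. -/
theorem exists_aeval_sq_eq (M : Matrix n n ℂ) (hM : IsUnit M.det) :
    ∃ p : ℂ[X], (Polynomial.aeval M p) ^ 2 = M := by
  obtain ⟨p, c, hp⟩ := exists_dvd_sq_sub_X M.charpoly (by
    intro h
    apply hM.ne_zero
    rw [det_eq_sign_charpoly_coeff, Polynomial.coeff_zero_eq_eval_zero, h, mul_zero])
  refine ⟨p, ?_⟩
  have := congrArg (Polynomial.aeval M) hp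
  rw [map_mul, aeval_self_charpoly, zero_mul] at this
  simpa [sub_eq_zero] using this

theorem IsSymm.aeval {M : Matrix n n ℂ} (hM : M.IsSymm) (p : ℂ[X]) :
    (Polynomial.aeval M p).IsSymm := by
  induction p using Polynomial.induction_on' with
  | add p q hp hq => rw [map_add]; exact hp.add hq
  | monomial k a =>
    rw [Polynomial.aeval_monomial, ← Algebra.smul_def]
    exact (hM.pow k).smul a

/-- Similar complex symmetric matrices are conjugate under the complex orthogonal group. -/
theorem IsSymm.exists_orthogonal_conj {A B S : Matrix n n ℂ} (hA : A.IsSymm) (hB : B.IsSymm)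
    (hS : IsUnit S.det) (h : S * A = B * S) :
    ∃ T ∈ orthogonalGroup n ℂ, T * A * T⁻¹ = B := by
  have hM : (Sᵀ * S).IsSymm := by simp [IsSymm]
  have hMdet : IsUnit (Sᵀ * S).det := by
    rw [det_mul, det_transpose]; exact hS.mul hS
  have hcomm : Commute A (Sᵀ * S) := by
    have h' := congrArg Matrix.transpose h
    rw [transpose_mul, transpose_mul, hA.eq, hB.eq] at h'
    rw [Commute, SemiconjBy, ← mul_assoc, h', mul_assoc, ← h, mul_assoc]
  obtain ⟨p, hp⟩ := exists_aeval_sq_eq _ hMdet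
  set Q := Polynomial.aeval (Sᵀ * S) p with hQ
  have hQs : Q.IsSymm := hM.aeval p
  have hQA : Commute A Q := by
    rw [hQ, Polynomial.aeval_eq_sum_range]
    exact Commute.sum_right _ _ _ fun i _ => (hcomm.pow_right i).smul_right _
  have hQu : IsUnit Q.det := by
    rw [← hp, pow_two, det_mul] at hMdet
    exact isUnit_of_mul_isUnit_left hMdet
  have hT : (S * Q⁻¹)ᵀ * (S * Q⁻¹) = 1 := by
    rw [transpose_mul, transpose_nonsing_inv, hQs.eq, mul_assoc, ← mul_assoc Sᵀ, ← hp, pow_two,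
      mul_assoc, mul_nonsing_inv _ hQu, mul_one, nonsing_inv_mul _ hQu]
  refine ⟨S * Q⁻¹, (mem_orthogonalGroup_iff' n ℂ).mpr hT, ?_⟩
  rw [mul_inv_rev, nonsing_inv_nonsing_inv _ hQu]
  calc S * Q⁻¹ * A * (Q * S⁻¹) = S * Q⁻¹ * (A * Q) * S⁻¹ := by simp only [mul_assoc]
    _ = S * (Q⁻¹ * Q) * A * S⁻¹ := by rw [hQA.eq]; simp only [mul_assoc]
    _ = B := by
      rw [nonsing_inv_mul _ hQu, mul_one, h, mul_assoc, mul_nonsing_inv _ hS, mul_one]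

/-- An orthogonal `T` has determinant `±1`; `-T` conjugates in the same way, and in odd dimension
its determinant has the opposite sign. -/
theorem exists_specialOrthogonal_conj {A B : Matrix n n ℂ} (hn : Odd (Fintype.card n))
    (h : ∃ T ∈ orthogonalGroup n ℂ, T * A * T⁻¹ = B) :
    ∃ T ∈ specialOrthogonalGroup n ℂ, T * A * T⁻¹ = B := by
  obtain ⟨T, hT, hAB⟩ := h
  have hTT := (mem_orthogonalGroup_iff n ℂ).mp hT
  have hd : T.det * T.det = 1 := by
    simpa [det_mul] using congrArg det hTT
  rcases mul_self_eq_one_iff.mp hd with hd | hd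
  · exact ⟨T, mem_specialOrthogonalGroup_iff.mpr ⟨hT, hd⟩, hAB⟩
  · refine ⟨-T, mem_specialOrthogonalGroup_iff.mpr ⟨?_, ?_⟩, ?_⟩
    · rw [mem_orthogonalGroup_iff]; simpa using hTT
    · rw [det_neg, hn.neg_one_pow, hd]; norm_num
    · have : (-T)⁻¹ = -T⁻¹ := by
        apply inv_eq_right_inv
        rw [neg_mul_neg, mul_nonsing_inv _ (by rw [hd]; norm_num)]
      rw [this]; simpa using hAB

end Matrix

/-! ### Jordan bases from elementary divisors. -/

/-- Twice the nilpotent Jordan block, with nonzero entries below the diagonal. -/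
def doubleShift (k : ℕ) : Matrix (Fin k) (Fin k) ℂ :=
  Matrix.of fun i j => if (i : ℕ) = j + 1 then 2 else 0

section Basis
open Polynomial

theorem linearIndependent_mk_X_sub_C_pow (a : ℂ) (k : ℕ) :
    LinearIndependent ℂ fun j : Fin k =>
      Ideal.Quotient.mk (Ideal.span {(X - C a) ^ k}) ((X - C a) ^ (j : ℕ)) := by
  rw [Fintype.linearIndependent_iff]
  intro c hc i
  have h1 : Ideal.Quotient.mk (Ideal.span {(X - C a) ^ k})
      (∑ j : Fin k, C (c j) * (X - C a) ^ (j : ℕ)) = 0 := by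
    rw [map_sum, ← hc]
    refine Finset.sum_congr rfl fun j _ => ?_
    rw [← smul_eq_C_mul]
    rfl
  rw [Ideal.Quotient.eq_zero_iff_mem, Ideal.mem_span_singleton] at h1
  -- Translating `a` to `0` turns the divisor into `X ^ k`, and divisibility by it kills every
  -- coefficient below degree `k`.
  have h2 := map_dvd (compRingHom (X + C a)) h1
  have h3 : compRingHom (X + C a) (∑ j : Fin k, C (c j) * (X - C a) ^ (j : ℕ))
      = ∑ j : Fin k, C (c j) * X ^ (j : ℕ) := by
    simp [map_sum]
  rw [h3, map_pow, show compRingHom (X + C a) (X - C a) = X by simp, X_pow_dvd_iff] at h2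
  have := h2 i i.2
  simpa [finsetSum_coeff, coeff_C_mul, coeff_X_pow, Fin.val_inj] using this

theorem exists_basis_quotient_X_sub_C_pow (a : ℂ) (k : ℕ) :
    ∃ b : Module.Basis (Fin k) ℂ (ℂ[X] ⧸ Ideal.span {(X - C a) ^ k}),
      ∀ j, (X : ℂ[X]) • b j =
        ∑ i, (a • (1 : Matrix (Fin k) (Fin k) ℂ) + doubleShift k) i j • b i := by
  have hfin : Module.finrank ℂ (ℂ[X] ⧸ Ideal.span {(X - C a) ^ k}) = k := by
    rw [finrank_quotient_span_eq_natDegree, natDegree_pow, natDegree_X_sub_C, mul_one]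
  rcases Nat.eq_zero_or_pos k with rfl | hk
  · have : Subsingleton (ℂ[X] ⧸ Ideal.span {(X - C a) ^ 0}) := by
      rw [Ideal.Quotient.subsingleton_iff]; simp
    exact ⟨Module.Basis.empty _, fun j => j.elim0⟩
  have : Nonempty (Fin k) := ⟨⟨0, hk⟩⟩
  let v := basisOfLinearIndependentOfCardEqFinrank (linearIndependent_mk_X_sub_C_pow a k)
    (by rw [hfin, Fintype.card_fin])
  have hv : ∀ j, v j = Ideal.Quotient.mk _ ((X - C a) ^ (j : ℕ)) := fun j => by simp [v]
  -- Rescaling `(X - a) ^ j` by `2⁻¹ ^ j` turns the subdiagonal entries `1` of the Jordan block into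
  -- `2`, as in `doubleShift`.
  let w : Fin k → ℂˣ := fun j => Units.mk0 (2⁻¹ ^ (j : ℕ)) (pow_ne_zero _ (by norm_num))
  refine ⟨v.unitsSMul w, fun j => ?_⟩
  have hX : (X : ℂ[X]) • v j = a • v j + Ideal.Quotient.mk _ ((X - C a) ^ ((j : ℕ) + 1)) := by
    rw [hv]
    change Ideal.Quotient.mk _ (X * (X - C a) ^ (j : ℕ)) =
      Ideal.Quotient.mk _ (a • (X - C a) ^ (j : ℕ)) + _
    rw [← map_add, smul_eq_C_mul]
    congr 1; ring
  simp only [Module.Basis.unitsSMul_apply, Matrix.add_apply, add_smul, Finset.sum_add_distrib]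
  have e1 : ∑ i, (a • (1 : Matrix (Fin k) (Fin k) ℂ)) i j • w i • v i = a • w j • v j := by
    rw [Finset.sum_eq_single j]
    · simp
    · intro i _ hij; simp [hij]
    · simp
  have e2 : ∑ i, doubleShift k i j • w i • v i =
      w j • Ideal.Quotient.mk _ ((X - C a) ^ ((j : ℕ) + 1)) := by
    by_cases hj : (j : ℕ) + 1 < k
    · rw [Finset.sum_eq_single ⟨j + 1, hj⟩]
      · rw [hv]
        simp only [doubleShift, Matrix.of_apply, if_true, w, Units.smul_def, Units.val_mk0,
          smul_smul]
        congr 1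
        rw [pow_succ]; ring
      · intro i _ hij
        have : (i : ℕ) ≠ j + 1 := fun h => hij (Fin.ext h)
        simp [doubleShift, this]
      · simp
    · rw [Finset.sum_eq_zero]
      · have : (j : ℕ) + 1 = k := by omega
        have h0 : Ideal.Quotient.mk (Ideal.span {(X - C a) ^ k}) ((X - C a) ^ ((j : ℕ) + 1)) = 0 := by
          rw [Ideal.Quotient.eq_zero_iff_mem, this]
          exact Ideal.mem_span_singleton_self _
        rw [h0, smul_zero]
      · intro i _
        have : (i : ℕ) ≠ j + 1 := by omega
        simp [doubleShift, this]
  rw [e1, e2, Units.smul_def, Units.smul_def, smul_comm, hX, smul_add, smul_comm a]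

theorem HasElementaryDivisors.exists_basis {n t : ℕ} {A : Matrix (Fin n) (Fin n) ℂ}
    {l : Fin t → ℂ} {k : Fin t → ℕ} (h : HasElementaryDivisors A l k) :
    ∃ B : Module.Basis (Σ i, Fin (k i)) ℂ (Fin n → ℂ), ∀ x, A.mulVec (B x) =
      ∑ y, Matrix.blockDiagonal' (fun i => l i • (1 : Matrix (Fin (k i)) (Fin (k i)) ℂ) +
        doubleShift (k i)) y x • B y := by
  obtain ⟨-, ⟨f⟩⟩ := h
  choose b hb using fun i => exists_basis_quotient_X_sub_C_pow (l i) (k i)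
  let B₀ := DFinsupp.basis b
  let g : (⨁ i : Fin t, ℂ[X] ⧸ Ideal.span {(X - C (l i)) ^ k i}) ≃ₗ[ℂ] (Fin n → ℂ) :=
    (f.symm.restrictScalars ℂ).trans (Module.AEval'.of (Matrix.toLin' A)).symm
  have hg : ∀ y, g ((X : ℂ[X]) • y) = A.mulVec (g y) := fun y => by
    simp only [g, LinearEquiv.trans_apply, LinearEquiv.restrictScalars_apply, map_smul]
    rw [Module.AEval'.of_symm_X_smul, Matrix.toLin'_apply]
  have hB₀ : ∀ i j, B₀ ⟨i, j⟩ = DirectSum.lof ℂ[X] _ _ i (b i j) := fun i j => by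
    simp [B₀, DFinsupp.basis]
    rfl
  refine ⟨B₀.map g, fun ⟨i, j⟩ => ?_⟩
  simp only [Module.Basis.map_apply]
  rw [← hg, hB₀, ← map_smul, hb, Fintype.sum_sigma, Finset.sum_eq_single i]
  · rw [map_sum, map_sum]
    refine Finset.sum_congr rfl fun j' _ => ?_
    rw [Matrix.blockDiagonal'_apply_eq, hB₀, LinearMap.map_smul_of_tower, map_smul]
  · intro i' _ hi
    refine Finset.sum_eq_zero fun j' _ => ?_
    rw [Matrix.blockDiagonal'_apply_ne _ _ _ hi, zero_smul]
  · simp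

end Basis

namespace Matrix

theorem exists_mul_eq_mul_of_basis {n : Type*} [Fintype n] [DecidableEq n] {A M : Matrix n n ℂ}
    (b : Module.Basis n ℂ (n → ℂ)) (h : ∀ j, A.mulVec (b j) = ∑ i, M i j • b i) :
    ∃ S : Matrix n n ℂ, IsUnit S.det ∧ S * A = M * S := by
  let R : Matrix n n ℂ := (Pi.basisFun ℂ n).toMatrix b
  have hR : IsUnit R.det := by
    have := (Pi.basisFun ℂ n).invertibleToMatrix b
    exact (isUnit_iff_isUnit_det _).mp (isUnit_of_invertible R)
  have hAR : A * R = R * M := by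
    ext i j
    have := congrFun (h j) i
    simpa [R, mul_apply, mulVec, dotProduct, Module.Basis.toMatrix_apply, mul_comm] using this
  refine ⟨R⁻¹, isUnit_nonsing_inv_det _ hR, ?_⟩
  calc R⁻¹ * A = R⁻¹ * (A * R) * R⁻¹ := by
        rw [mul_assoc, mul_assoc, mul_nonsing_inv _ hR, mul_one]
    _ = M * R⁻¹ := by rw [hAR, ← mul_assoc, nonsing_inv_mul _ hR, one_mul]

end Matrix

/-! ### Symmetric representatives of Jordan blocks. -/

theorem symBlock_isSymm (k : ℕ) : (symBlock k).IsSymm := by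
  ext i j
  simp only [symBlock, Matrix.transpose_apply, Matrix.of_apply, or_comm, add_comm (j : ℕ) (i : ℕ)]

/-- Let `V` reverse the order of the basis and let `N` be the lower shift. Then `V * V = 1` and `V *
N * V = Nᵀ`, so `1 + iV` has inverse `(1 - iV) / 2` and conjugates `2N` to `N + Nᵀ + i(VN - NV)`,
which is `symBlock k`. -/
theorem exists_symBlock_mul_eq (k : ℕ) : ∃ U : Matrix (Fin k) (Fin k) ℂ,
    IsUnit U.det ∧ U * doubleShift k = symBlock k * U := by
  let V : Matrix (Fin k) (Fin k) ℂ := (1 : Matrix (Fin k) (Fin k) ℂ).submatrix Fin.revPerm id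
  have hV1 : ∀ M : Matrix (Fin k) (Fin k) ℂ, V * M = M.submatrix Fin.rev id := fun M => by
    ext i j; simp [V, Matrix.mul_apply, Matrix.one_apply]
  have hV2 : ∀ M : Matrix (Fin k) (Fin k) ℂ, M * V = M.submatrix id Fin.rev := fun M => by
    ext i j
    simp only [V, Matrix.mul_apply, Matrix.one_apply, Matrix.submatrix_apply, id]
    rw [Finset.sum_eq_single (Fin.rev j)]
    · simp
    · intro x _ hx
      rw [if_neg, mul_zero]
      rintro rfl; simp at hx
    · simp
  have hVV : V * V = 1 := by rw [hV1]; ext i j; simp [V, Matrix.one_apply]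
  refine ⟨1 + Complex.I • V, ?_, ?_⟩
  · have h : (1 + Complex.I • V) * ((2⁻¹ : ℂ) • (1 - Complex.I • V)) = 1 := by
      rw [mul_smul_comm, add_mul, one_mul, mul_sub, mul_one, smul_mul_smul_comm, hVV,
        Complex.I_mul_I]
      ext i j; simp; ring
    exact Matrix.isUnit_det_of_right_inverse h
  · rw [add_mul, mul_add, one_mul, mul_one, smul_mul_assoc, mul_smul_comm, hV1, hV2]
    ext i j
    have hj := Fin.val_rev j
    have hi := Fin.val_rev i
    simp only [symBlock, doubleShift, Matrix.add_apply, Matrix.smul_apply, Matrix.submatrix_apply,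
      Matrix.of_apply, id, smul_eq_mul]
    have e1 : ((Fin.rev i : ℕ) = j + 1) ↔ (i : ℕ) + j + 2 = k := by omega
    have e2 : ((i : ℕ) + 1 = (Fin.rev j : ℕ)) ↔ (i : ℕ) + j + 2 = k := by omega
    have e3 : ((Fin.rev j : ℕ) + 1 = (i : ℕ)) ↔ (i : ℕ) + j = k := by omega
    have e4 : ((i : ℕ) + (Fin.rev j : ℕ) + 2 = k) ↔ (i : ℕ) + 1 = j := by omega
    have e5 : ((i : ℕ) + (Fin.rev j : ℕ) = k) ↔ (i : ℕ) = j + 1 := by omega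
    have e6 : ((j : ℕ) + 1 = (i : ℕ)) ↔ (i : ℕ) = j + 1 := eq_comm
    simp only [e1, e2, e3, e4, e5, e6]
    have hI := Complex.I_mul_I
    split_ifs <;> first | omega | skip
    all_goals first | ring1 | linear_combination hI | linear_combination -hI

theorem HasElementaryDivisors.sum_eq {n t : ℕ} {A : Matrix (Fin n) (Fin n) ℂ}
    {l : Fin t → ℂ} {k : Fin t → ℕ} (h : HasElementaryDivisors A l k) : ∑ i, k i = n := by
  obtain ⟨B, -⟩ := h.exists_basis
  simpa using (Module.finrank_eq_card_basis B).symm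

/-- The enumeration `e` is arbitrary so that the `3 × 3` forms can place their blocks in the order
required by the list. -/
theorem HasElementaryDivisors.exists_similar {n t : ℕ} {A : Matrix (Fin n) (Fin n) ℂ}
    {l : Fin t → ℂ} {k : Fin t → ℕ} (h : HasElementaryDivisors A l k)
    (e : (Σ i, Fin (k i)) ≃ Fin n) :
    ∃ S : Matrix (Fin n) (Fin n) ℂ, IsUnit S.det ∧ S * A =
      Matrix.reindex e e (Matrix.blockDiagonal' fun i =>
        l i • (1 : Matrix (Fin (k i)) (Fin (k i)) ℂ) + symBlock (k i)) * S := by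
  obtain ⟨B, hB⟩ := h.exists_basis
  set N := Matrix.blockDiagonal' fun i =>
    l i • (1 : Matrix (Fin (k i)) (Fin (k i)) ℂ) + doubleShift (k i) with hN
  set D := Matrix.blockDiagonal' fun i =>
    l i • (1 : Matrix (Fin (k i)) (Fin (k i)) ℂ) + symBlock (k i) with hD
  obtain ⟨S, hS, hSA⟩ := Matrix.exists_mul_eq_mul_of_basis (A := A) (M := Matrix.reindex e e N)
    (B.reindex e) (fun j => by
      rw [Module.Basis.reindex_apply, hB, ← e.sum_comp]
      simp)
  choose U hU hUD using fun i => exists_symBlock_mul_eq (k i)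
  have hUN : Matrix.blockDiagonal' U * N = D * Matrix.blockDiagonal' U := by
    rw [hN, hD, ← Matrix.blockDiagonal'_mul, ← Matrix.blockDiagonal'_mul]
    congr 1
    funext i
    rw [mul_add, add_mul, hUD, mul_smul_comm, mul_one, smul_mul_assoc, one_mul]
  have hUu : IsUnit (Matrix.blockDiagonal' U).det := by
    refine Matrix.isUnit_det_of_right_inverse (B := Matrix.blockDiagonal' fun i => (U i)⁻¹) ?_
    rw [← Matrix.blockDiagonal'_mul, ← Matrix.blockDiagonal'_one]
    congr 1
    funext i
    exact Matrix.mul_nonsing_inv _ (hU i)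
  refine ⟨Matrix.reindex e e (Matrix.blockDiagonal' U) * S, ?_, ?_⟩
  · rw [Matrix.det_mul, Matrix.det_reindex_self]
    exact hUu.mul hS
  · rw [mul_assoc, hSA, ← mul_assoc, ← mul_assoc]
    simp only [Matrix.reindex_apply, Matrix.submatrix_mul_equiv]
    rw [hUN]

theorem symNormalForm_isSymm {n t : ℕ} (l : Fin t → ℂ) (k : Fin t → ℕ) (h : ∑ i, k i = n) :
    (symNormalForm l k h).IsSymm := by
  have : ∀ i, (l i • (1 : Matrix (Fin (k i)) (Fin (k i)) ℂ) + symBlock (k i)).transpose =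
      l i • (1 : Matrix (Fin (k i)) (Fin (k i)) ℂ) + symBlock (k i) := fun i => by
    rw [Matrix.transpose_add, Matrix.transpose_smul, Matrix.transpose_one,
      (symBlock_isSymm (k i)).eq]
  rw [Matrix.IsSymm, symNormalForm, Matrix.transpose_reindex, Matrix.blockDiagonal'_transpose]
  simp only [this]

/-! ### Existence of elementary divisors. -/

section Existence
open Polynomial

/-- Used to discard the summands with exponent `0`, which the structure theorem allows and
`HasElementaryDivisors` does not. -/
theorem DirectSum.exists_equiv_subtype {R ι : Type*} [CommRing R] [Fintype ι] (M : ι → Type*)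
    [∀ i, AddCommGroup (M i)] [∀ i, Module R (M i)] (p : ι → Prop)
    (hp : ∀ i, ¬ p i → Subsingleton (M i)) :
    Nonempty ((⨁ i, M i) ≃ₗ[R] ⨁ i : {i // p i}, M i) := by
  classical
  refine ⟨LinearEquiv.ofBijective (DFinsupp.subtypeDomainLinearMap R M p) ⟨?_, ?_⟩⟩
  · intro x y hxy
    refine DFinsupp.ext fun i => ?_
    by_cases hi : p i
    · exact DFunLike.congr_fun hxy (⟨i, hi⟩ : {i // p i})
    · have := hp i hi
      exact Subsingleton.elim _ _
  · intro y
    refine ⟨DFinsupp.equivFunOnFintype.symm fun i => if h : p i then y ⟨i, h⟩ else 0, ?_⟩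
    refine DFinsupp.ext fun i => ?_
    simp only [DFinsupp.subtypeDomainLinearMap_apply, DFinsupp.subtypeDomain_apply]
    exact dif_pos i.2

theorem exists_hasElementaryDivisors {n : ℕ} (A : Matrix (Fin n) (Fin n) ℂ) :
    ∃ (t : ℕ) (l : Fin t → ℂ) (k : Fin t → ℕ), HasElementaryDivisors A l k := by
  obtain ⟨ι, _, p, hp, e, ⟨f⟩⟩ := Module.equiv_directSum_of_isTorsion
    (Module.AEval.isTorsion_of_finiteDimensional ℂ (Fin n → ℂ) (Matrix.toLin' A))
  have hroot : ∀ i, ∃ a : ℂ, Associated (p i) (X - C a) := fun i => by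
    obtain ⟨a, ha⟩ := IsAlgClosed.exists_root (p i)
      (by rw [IsAlgClosed.degree_eq_one_of_irreducible ℂ (hp i)]; exact one_ne_zero)
    exact ⟨a, ((irreducible_X_sub_C a).associated_of_dvd (hp i) (dvd_iff_isRoot.mpr ha)).symm⟩
  choose a ha using hroot
  obtain ⟨g⟩ := DirectSum.exists_equiv_subtype (R := ℂ[X])
    (fun i => ℂ[X] ⧸ Ideal.span {p i ^ e i}) (fun i => 0 < e i) (fun i hi => by
      rw [Ideal.Quotient.subsingleton_iff, Nat.eq_zero_of_not_pos hi]
      simp)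
  let r := (Fintype.equivFin {i // 0 < e i})
  refine ⟨_, fun j => a (r.symm j), fun j => e (r.symm j), fun j => (r.symm j).2, ⟨?_⟩⟩
  have c : ∀ j, (ℂ[X] ⧸ Ideal.span {p (r.symm j) ^ e (r.symm j)}) ≃ₗ[ℂ[X]]
      ℂ[X] ⧸ Ideal.span {(X - C (a (r.symm j))) ^ e (r.symm j)} := fun j =>
    Submodule.quotEquivOfEq _ _ (Ideal.span_singleton_eq_span_singleton.mpr ((ha _).pow_pow))
  exact f.trans (g.trans ((DirectSum.lequivCongrLeft ℂ[X] r).trans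
    (DFinsupp.mapRange.linearEquiv c)))

end Existence

/-! ### The `3 × 3` list: Jordan types and ranks. -/

/-- A `3 × 3` symmetric normal form with a simple block of eigenvalue `a` and a block of size two
of eigenvalue `b`; the simple block comes first, unless `a = 0`. -/
noncomputable def twoForm (a b : ℂ) : Matrix (Fin 3) (Fin 3) ℂ :=
  open Classical in
  if a = 0 then !![b + Complex.I, 1, 0; 1, b - Complex.I, 0; 0, 0, 0]
  else !![a, 0, 0; 0, b + Complex.I, 1; 0, 1, b - Complex.I]

/-- The `3 × 3` symmetric normal form with a single block of eigenvalue `a`. -/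
noncomputable def threeForm (a : ℂ) : Matrix (Fin 3) (Fin 3) ℂ :=
  !![a, 1 + Complex.I, 0; 1 + Complex.I, a, 1 - Complex.I; 0, 1 - Complex.I, a]

theorem twoForm_zero (b : ℂ) :
    twoForm 0 b = !![b + Complex.I, 1, 0; 1, b - Complex.I, 0; 0, 0, 0] := if_pos rfl

theorem twoForm_of_ne_zero {a : ℂ} (ha : a ≠ 0) (b : ℂ) :
    twoForm a b = !![a, 0, 0; 0, b + Complex.I, 1; 0, 1, b - Complex.I] := if_neg ha

theorem diagonal_fin_three (a b c : ℂ) :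
    Matrix.diagonal ![a, b, c] = !![a, 0, 0; 0, b, 0; 0, 0, c] := by
  ext i j; fin_cases i <;> fin_cases j <;> rfl

/-- Forgetting which eigenvalues vanish leaves one family per Jordan type, so uniqueness has nine
cases to compare. -/
theorem IsNormalForm3.cases_form {r : ℕ} {P : Matrix (Fin 3) (Fin 3) ℂ} (h : IsNormalForm3 r P) :
    (∃ d, P = Matrix.diagonal d) ∨ (∃ a b, P = twoForm a b) ∨ ∃ a, P = threeForm a := by
  cases h with
  | rank3_diag | rank2_diag | rank1_diag | rank0 => exact .inl ⟨_, (diagonal_fin_three _ _ _).symm⟩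
  | rank3_two ha hb => exact .inr (.inl ⟨_, _, (twoForm_of_ne_zero ha _).symm⟩)
  | rank2_two hb => exact .inr (.inl ⟨_, _, (twoForm_zero _).symm⟩)
  | rank2_two_zero ha =>
    exact .inr (.inl ⟨_, 0, by rw [twoForm_of_ne_zero ha, zero_add, zero_sub]⟩)
  | rank1_two => exact .inr (.inl ⟨0, 0, by rw [twoForm_zero, zero_add, zero_sub]⟩)
  | rank3_three | rank2_three => exact .inr (.inr ⟨_, rfl⟩)

theorem IsNormalForm3.isSymm {r : ℕ} {P : Matrix (Fin 3) (Fin 3) ℂ} (h : IsNormalForm3 r P) :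
    P.IsSymm := by
  cases h <;> · ext i j; fin_cases i <;> fin_cases j <;> rfl

theorem rank_mul_diagonal_mul {P L R : Matrix (Fin 3) (Fin 3) ℂ} {a b c : ℂ}
    (h : P = L * !![a, 0, 0; 0, b, 0; 0, 0, c] * R) (hL : L.det ≠ 0) (hR : R.det ≠ 0) :
    P.rank = (if a ≠ 0 then 1 else 0) + (if b ≠ 0 then 1 else 0) + (if c ≠ 0 then 1 else 0) := by
  rw [h, Matrix.rank_mul_eq_left_of_isUnit_det _ _ hR.isUnit,
    Matrix.rank_mul_eq_right_of_isUnit_det _ _ hL.isUnit, ← diagonal_fin_three,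
    Matrix.rank_diagonal, Fintype.card_subtype, Finset.card_filter, Fin.sum_univ_three]
  rfl

theorem one_add_I_ne_zero : (1 + Complex.I : ℂ) ≠ 0 := fun h => by
  simpa using congrArg Complex.re h

theorem IsNormalForm3.rank_eq {r : ℕ} {P : Matrix (Fin 3) (Fin 3) ℂ} (h : IsNormalForm3 r P) :
    P.rank = r := by
  have hI := Complex.I_mul_I
  cases h with
  | @rank3_diag a b c ha hb hc =>
    rw [rank_mul_diagonal_mul (L := 1)
      (a := a) (b := b) (c := c) (R := 1) (by simp) (by simp) (by simp)]
    simp [ha, hb, hc]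
  | @rank2_diag a b ha hb =>
    rw [rank_mul_diagonal_mul (L := 1)
      (a := a) (b := b) (c := 0) (R := 1) (by simp) (by simp) (by simp)]
    simp [ha, hb]
  | @rank1_diag a ha =>
    rw [rank_mul_diagonal_mul (L := 1)
      (a := a) (b := 0) (c := 0) (R := 1) (by simp) (by simp) (by simp)]
    simp [ha]
  | rank0 =>
    rw [rank_mul_diagonal_mul (L := 1)
      (a := 0) (b := 0) (c := 0) (R := 1) (by simp) (by simp) (by simp)]
    simp
  | @rank3_two a b ha hb =>
    refine (Matrix.rank_of_det_ne_zero ?_).trans (Fintype.card_fin 3)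
    have : a * b ^ 2 ≠ 0 := mul_ne_zero ha (pow_ne_zero _ hb)
    convert this using 1
    rw [Matrix.det_fin_three]; simp
    linear_combination (-a) * hI
  | @rank3_three a ha =>
    refine (Matrix.rank_of_det_ne_zero ?_).trans (Fintype.card_fin 3)
    have : a ^ 3 ≠ 0 := pow_ne_zero _ ha
    convert this using 1
    rw [Matrix.det_fin_three]; simp
    linear_combination (-2 * a) * hI
  | @rank2_two a ha =>
    rw [rank_mul_diagonal_mul (L := !![a + Complex.I, 1, 0; 1, a - Complex.I, 0; 0, 0, 1])
      (a := 1) (b := 1) (c := 0) (R := 1)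
      ?_ ?_ (by simp)]
    · simp
    · ext i j
      fin_cases i <;> fin_cases j <;> simp [Matrix.mul_apply, Fin.sum_univ_three]
    · convert pow_ne_zero 2 ha using 1
      rw [Matrix.det_fin_three]; simp
      linear_combination -hI
  | @rank2_two_zero a ha =>
    rw [rank_mul_diagonal_mul (L := !![1, 0, 0; 0, Complex.I, 0; 0, 1, 1])
      (a := a) (b := 1) (c := 0) (R := !![1, 0, 0; 0, 1, -Complex.I; 0, 0, 1])
      ?_ ?_ ?_]
    · simp [ha]
    · ext i j
      fin_cases i <;> fin_cases j <;> simp [Matrix.mul_apply, Fin.sum_univ_three]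
    · simp [Matrix.det_fin_three]
    · simp [Matrix.det_fin_three]
  | rank2_three =>
    rw [rank_mul_diagonal_mul (L := !![0, 1 + Complex.I, 0; 1 + Complex.I, 0, 0; 0, 1 - Complex.I, 1])
      (a := 1) (b := 1) (c := 0) (R := !![1, 0, -Complex.I; 0, 1, 0; 0, 0, 1]) ?_ ?_ ?_]
    · simp
    · ext i j
      fin_cases i <;> fin_cases j <;> simp [Matrix.mul_apply, Fin.sum_univ_three]
      linear_combination hI
    · simp [Matrix.det_fin_three, one_add_I_ne_zero]
    · simp [Matrix.det_fin_three]
  | rank1_two =>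
    rw [rank_mul_diagonal_mul (L := !![Complex.I, 0, 0; 1, 1, 0; 0, 0, 1])
      (a := 1) (b := 0) (c := 0) (R := !![1, -Complex.I, 0; 0, 1, 0; 0, 0, 1]) ?_ ?_ ?_]
    · simp
    · ext i j
      fin_cases i <;> fin_cases j <;> simp [Matrix.mul_apply, Fin.sum_univ_three]
    · simp [Matrix.det_fin_three]
    · simp [Matrix.det_fin_three]

/-! ### Every `3 × 3` matrix is similar to a listed form. -/

theorem exists_isNormalForm3_diagonal (d : Fin 3 → ℂ) :
    ∃ (σ : Equiv.Perm (Fin 3)) (r : ℕ), IsNormalForm3 r (Matrix.diagonal (d ∘ σ)) := by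
  classical
  -- Sorting by `f` moves the zero entries to the end, as in the list; monotonicity excludes the
  -- other zero patterns.
  let f : Fin 3 → ℕ := fun i => if d i = 0 then 1 else 0
  have hf := Tuple.monotone_sort f
  refine ⟨Tuple.sort f, ?_⟩
  have h01 : f (Tuple.sort f 0) ≤ f (Tuple.sort f 1) := hf (by decide)
  have h12 : f (Tuple.sort f 1) ≤ f (Tuple.sort f 2) := hf (by decide)
  set σ := Tuple.sort f
  have e : Matrix.diagonal (d ∘ σ) = !![d (σ 0), 0, 0; 0, d (σ 1), 0; 0, 0, d (σ 2)] := by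
    rw [← diagonal_fin_three]
    congr 1
    ext i; fin_cases i <;> rfl
  rw [e]
  by_cases h0 : d (σ 0) = 0 <;> by_cases h1 : d (σ 1) = 0 <;> by_cases h2 : d (σ 2) = 0 <;>
    simp [f, h0, h1, h2] at h01 h12
  · rw [h0, h1, h2]; exact ⟨_, .rank0⟩
  · rw [h1, h2]; exact ⟨_, .rank1_diag h0⟩
  · rw [h2]; exact ⟨_, .rank2_diag h0 h1⟩
  · exact ⟨_, .rank3_diag h0 h1 h2⟩

theorem exists_isNormalForm3_twoForm (a b : ℂ) : ∃ r, IsNormalForm3 r (twoForm a b) := by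
  rcases eq_or_ne a 0 with rfl | ha
  · rw [twoForm_zero]
    rcases eq_or_ne b 0 with rfl | hb
    · rw [zero_add, zero_sub]; exact ⟨_, .rank1_two⟩
    · exact ⟨_, .rank2_two hb⟩
  · rw [twoForm_of_ne_zero ha]
    rcases eq_or_ne b 0 with rfl | hb
    · rw [zero_add, zero_sub]; exact ⟨_, .rank2_two_zero ha⟩
    · exact ⟨_, .rank3_two ha hb⟩

theorem exists_isNormalForm3_threeForm (a : ℂ) : ∃ r, IsNormalForm3 r (threeForm a) := by
  rcases eq_or_ne a 0 with rfl | ha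
  · exact ⟨_, .rank2_three⟩
  · exact ⟨_, .rank3_three ha⟩

theorem blockDiagonal'_symBlock_apply {t : ℕ} (l : Fin t → ℂ) (k : Fin t → ℕ)
    (p q : Σ i, Fin (k i)) :
    Matrix.blockDiagonal' (fun i =>
        l i • (1 : Matrix (Fin (k i)) (Fin (k i)) ℂ) + symBlock (k i)) p q =
      if p.1 = q.1 then (if (p.2 : ℕ) = q.2 then l p.1 else 0) +
        ((if (p.2 : ℕ) + 1 = q.2 ∨ (q.2 : ℕ) + 1 = p.2 then 1 else 0) +
          Complex.I * ((if (p.2 : ℕ) + q.2 + 2 = k p.1 then 1 else 0) -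
            (if (p.2 : ℕ) + q.2 = k p.1 then 1 else 0)))
      else 0 := by
  obtain ⟨i, x⟩ := p
  obtain ⟨j, y⟩ := q
  rcases eq_or_ne i j with rfl | hij
  · simp [symBlock, Matrix.one_apply, Fin.ext_iff]
  · rw [Matrix.blockDiagonal'_apply_ne _ _ _ hij, if_neg hij]

/-- With the block entries spelled out, a candidate form is checked entry by entry once `g` says
which block position each index occupies. -/
theorem HasElementaryDivisors.exists_similar_of_bijective {n t : ℕ} {A : Matrix (Fin n) (Fin n) ℂ}
    {l : Fin t → ℂ} {k : Fin t → ℕ} (h : HasElementaryDivisors A l k)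
    {g : Fin n → Σ i, Fin (k i)} (hg : Function.Bijective g) {P : Matrix (Fin n) (Fin n) ℂ}
    (hP : ∀ x y, (if (g x).1 = (g y).1 then (if ((g x).2 : ℕ) = (g y).2 then l (g x).1 else 0) +
        ((if ((g x).2 : ℕ) + 1 = (g y).2 ∨ ((g y).2 : ℕ) + 1 = (g x).2 then 1 else 0) +
          Complex.I * ((if ((g x).2 : ℕ) + (g y).2 + 2 = k (g x).1 then 1 else 0) -
            (if ((g x).2 : ℕ) + (g y).2 = k (g x).1 then 1 else 0)))
      else 0) = P x y) :
    ∃ S : Matrix (Fin n) (Fin n) ℂ, IsUnit S.det ∧ S * A = P * S := by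
  obtain ⟨S, hS, hSA⟩ := h.exists_similar (Equiv.ofBijective g hg).symm
  refine ⟨S, hS, hSA.trans ?_⟩
  congr 1
  ext x y
  exact (blockDiagonal'_symBlock_apply l k (g x) (g y)).trans (hP x y)

theorem exists_similar_isNormalForm3 (A : Matrix (Fin 3) (Fin 3) ℂ) :
    ∃ (r : ℕ) (P : Matrix (Fin 3) (Fin 3) ℂ), IsNormalForm3 r P ∧
      ∃ S : Matrix (Fin 3) (Fin 3) ℂ, IsUnit S.det ∧ S * A = P * S := by
  obtain ⟨t, l, k, h⟩ := exists_hasElementaryDivisors A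
  have hk := h.1
  have hsum := h.sum_eq
  have ht : t ≤ 3 := by
    calc t = ∑ i : Fin t, 1 := by simp
      _ ≤ ∑ i, k i := Finset.sum_le_sum fun i _ => hk i
      _ = 3 := hsum
  interval_cases t
  · simp at hsum
  · obtain rfl : k = ![3] := by
      ext i; fin_cases i; simpa using hsum
    obtain ⟨r, hr⟩ := exists_isNormalForm3_threeForm (l 0)
    refine ⟨r, _, hr, h.exists_similar_of_bijective
      (g := ![⟨0, ⟨0, by decide⟩⟩, ⟨0, ⟨1, by decide⟩⟩, ⟨0, ⟨2, by decide⟩⟩]) (by decide) ?_⟩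
    intro x y
    fin_cases x <;> fin_cases y <;> simp [threeForm, sub_eq_add_neg]
  · rw [Fin.sum_univ_two] at hsum
    have h0 := hk 0
    have h1 := hk 1
    have : k = ![1, 2] ∨ k = ![2, 1] := by
      have : k 0 = 1 ∨ k 0 = 2 := by omega
      refine this.imp (fun hh => ?_) (fun hh => ?_) <;>
      · ext i
        fin_cases i <;> simp <;> omega
    rcases this with rfl | rfl
    · obtain ⟨r, hr⟩ := exists_isNormalForm3_twoForm (l 0) (l 1)
      refine ⟨r, _, hr, ?_⟩
      -- A zero simple block is listed last and a nonzero one first, so `g` differs between the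
      -- cases.
      by_cases hl : l 0 = 0
      · refine h.exists_similar_of_bijective
          (g := ![⟨1, ⟨0, by decide⟩⟩, ⟨1, ⟨1, by decide⟩⟩, ⟨0, ⟨0, by decide⟩⟩]) (by decide) ?_
        intro x y
        rw [hl, twoForm_zero]
        fin_cases x <;> fin_cases y <;> simp [hl, sub_eq_add_neg]
      · refine h.exists_similar_of_bijective
          (g := ![⟨0, ⟨0, by decide⟩⟩, ⟨1, ⟨0, by decide⟩⟩, ⟨1, ⟨1, by decide⟩⟩]) (by decide) ?_
        intro x y
        rw [twoForm_of_ne_zero hl]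
        fin_cases x <;> fin_cases y <;> simp [sub_eq_add_neg]
    · obtain ⟨r, hr⟩ := exists_isNormalForm3_twoForm (l 1) (l 0)
      refine ⟨r, _, hr, ?_⟩
      by_cases hl : l 1 = 0
      · refine h.exists_similar_of_bijective
          (g := ![⟨0, ⟨0, by decide⟩⟩, ⟨0, ⟨1, by decide⟩⟩, ⟨1, ⟨0, by decide⟩⟩]) (by decide) ?_
        intro x y
        rw [hl, twoForm_zero]
        fin_cases x <;> fin_cases y <;> simp [hl, sub_eq_add_neg]
      · refine h.exists_similar_of_bijective
          (g := ![⟨1, ⟨0, by decide⟩⟩, ⟨0, ⟨0, by decide⟩⟩, ⟨0, ⟨1, by decide⟩⟩]) (by decide) ?_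
        intro x y
        rw [twoForm_of_ne_zero hl]
        fin_cases x <;> fin_cases y <;> simp [sub_eq_add_neg]
  · obtain rfl : k = fun _ => 1 := by
      have h0 := hk 0
      have h1 := hk 1
      have h2 := hk 2
      rw [Fin.sum_univ_three] at hsum
      ext i; fin_cases i <;> simp <;> omega
    obtain ⟨σ, r, hr⟩ := exists_isNormalForm3_diagonal l
    refine ⟨r, _, hr, h.exists_similar_of_bijective (g := fun i => ⟨σ i, 0⟩) ⟨?_, ?_⟩ ?_⟩
    · intro x y hxy
      simpa using hxy
    · rintro ⟨i, j⟩
      exact ⟨σ.symm i, by simp [Subsingleton.elim j 0]⟩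
    · intro x y
      rcases eq_or_ne x y with rfl | hxy
      · simp
      · simp [hxy]

/-! ### Similarity invariants and uniqueness. -/

section Uniqueness

variable {n : Type*} [Fintype n] [DecidableEq n] {P Q S : Matrix n n ℂ}

theorem Matrix.mul_sub_smul_one_eq (h : S * P = Q * S) (x : ℂ) :
    S * (P - x • 1) = (Q - x • 1) * S := by
  rw [mul_sub, sub_mul, h, mul_smul_comm, smul_mul_assoc, mul_one, one_mul]

theorem Matrix.det_sub_smul_one_eq (hS : IsUnit S.det) (h : S * P = Q * S) (x : ℂ) :
    (P - x • 1).det = (Q - x • 1).det := by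
  have := congrArg Matrix.det (Matrix.mul_sub_smul_one_eq h x)
  rw [Matrix.det_mul, Matrix.det_mul, mul_comm] at this
  exact mul_right_cancel₀ hS.ne_zero this

theorem Matrix.mul_sq_sub_smul_one_eq (h : S * P = Q * S) (x : ℂ) :
    S * (P - x • 1) ^ 2 = (Q - x • 1) ^ 2 * S := by
  rw [pow_two, pow_two, ← mul_assoc, Matrix.mul_sub_smul_one_eq h, mul_assoc,
    Matrix.mul_sub_smul_one_eq h, mul_assoc]

/-- For a diagonal matrix `D`, `D - x • 1` and its square have the same kernel. The columns of `M`
show that this fails for `Q`. -/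
theorem not_similar_diagonal (hS : IsUnit S.det) {d : n → ℂ} (h : S * Matrix.diagonal d = Q * S)
    {x : ℂ} {M : Matrix n n ℂ} (h1 : (Q - x • 1) ^ 2 * M = 0) (h2 : (Q - x • 1) * M ≠ 0) :
    False := by
  have hinv : S * (S⁻¹ * M) = M := by rw [← mul_assoc, Matrix.mul_nonsing_inv _ hS, one_mul]
  have key : ∀ R : Matrix n n ℂ, S * R = 0 → R = 0 := fun R hR => by
    have := congrArg (S⁻¹ * ·) hR
    simpa [← mul_assoc, Matrix.nonsing_inv_mul _ hS] using this
  have e1 : (Matrix.diagonal d - x • 1) ^ 2 * (S⁻¹ * M) = 0 := by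
    apply key
    rw [← mul_assoc, Matrix.mul_sq_sub_smul_one_eq h, mul_assoc, hinv, h1]
  have e2 : (Matrix.diagonal d - x • 1) * (S⁻¹ * M) = 0 := by
    have hd : Matrix.diagonal d - x • 1 = Matrix.diagonal fun i => d i - x := by
      rw [Matrix.smul_one_eq_diagonal, Matrix.diagonal_sub]
    rw [hd, Matrix.diagonal_pow] at e1
    rw [hd]
    ext i j
    have := congrFun (congrFun e1 i) j
    rw [Matrix.diagonal_mul] at this ⊢
    simpa using this
  apply h2
  rw [← hinv, ← mul_assoc, ← Matrix.mul_sub_smul_one_eq h, mul_assoc, e2, mul_zero]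

end Uniqueness

theorem det_diagonal_sub (d : Fin 3 → ℂ) (x : ℂ) :
    (Matrix.diagonal d - x • 1).det = (d 0 - x) * (d 1 - x) * (d 2 - x) := by
  rw [Matrix.smul_one_eq_diagonal, Matrix.diagonal_sub, Matrix.det_diagonal, Fin.prod_univ_three]

theorem det_twoForm_sub (a b x : ℂ) :
    (twoForm a b - x • 1).det = (a - x) * (b - x) ^ 2 := by
  rcases eq_or_ne a 0 with rfl | ha
  · rw [twoForm_zero, Matrix.det_fin_three]
    simp
    linear_combination x * Complex.I_mul_I
  · rw [twoForm_of_ne_zero ha, Matrix.det_fin_three]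
    simp
    linear_combination (x - a) * Complex.I_mul_I

theorem det_threeForm_sub (a x : ℂ) : (threeForm a - x • 1).det = (a - x) ^ 3 := by
  rw [threeForm, Matrix.det_fin_three]
  simp
  linear_combination (2 * x - 2 * a) * Complex.I_mul_I

/-- The values at `0`, `1`, `-1` give the first two elementary symmetric functions. Evaluating at
`d' 0` matches it with some `d i`; the other two entries are then determined as a pair by sum and
product. -/
theorem exists_perm_of_prod_sub_eq {d d' : Fin 3 → ℂ}
    (h : ∀ x, (d 0 - x) * (d 1 - x) * (d 2 - x) = (d' 0 - x) * (d' 1 - x) * (d' 2 - x)) :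
    ∃ σ : Equiv.Perm (Fin 3), d' = d ∘ σ := by
  have e0 := h 0
  have e1 := h 1
  have e2 := h (-1)
  have s1 : d 0 + d 1 + d 2 = d' 0 + d' 1 + d' 2 := by
    linear_combination (e1 + e2) / 2 - e0
  have s2 : d 0 * d 1 + d 0 * d 2 + d 1 * d 2 = d' 0 * d' 1 + d' 0 * d' 2 + d' 1 * d' 2 := by
    linear_combination (e2 - e1) / 2
  have mk : ∀ σ : Equiv.Perm (Fin 3), d' 0 = d (σ 0) → d' 1 = d (σ 1) → d' 2 = d (σ 2) →
      ∃ σ : Equiv.Perm (Fin 3), d' = d ∘ σ := fun σ h0 h1 h2 =>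
    ⟨σ, funext fun i => by fin_cases i <;> assumption⟩
  have pair : ∀ a b a' b' : ℂ, a + b = a' + b' → a * b = a' * b' →
      (a' = a ∧ b' = b) ∨ (a' = b ∧ b' = a) := fun a b a' b' hs hp => by
    have : (a' - a) * (a' - b) = 0 := by linear_combination hp - a' * hs
    rcases mul_eq_zero.mp this with h | h
    · exact .inl ⟨sub_eq_zero.mp h, by linear_combination -h - hs⟩
    · exact .inr ⟨sub_eq_zero.mp h, by linear_combination -h - hs⟩
  have h0 : (d 0 - d' 0) * (d 1 - d' 0) * (d 2 - d' 0) = 0 := by rw [h]; ring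
  rcases mul_eq_zero.mp h0 with h0 | h0
  · rcases mul_eq_zero.mp h0 with h0 | h0
    · rcases pair (d 1) (d 2) (d' 1) (d' 2) (by linear_combination s1 - h0)
        (by linear_combination s2 - (d' 1 + d' 2) * h0 - d 0 * (s1 - h0)) with ⟨h1, h2⟩ | ⟨h1, h2⟩
      · exact mk 1 (sub_eq_zero.mp h0).symm h1 h2
      · exact mk (Equiv.swap 1 2) (sub_eq_zero.mp h0).symm h1 h2
    · rcases pair (d 0) (d 2) (d' 1) (d' 2) (by linear_combination s1 - h0)
        (by linear_combination s2 - (d' 1 + d' 2) * h0 - d 1 * (s1 - h0)) with ⟨h1, h2⟩ | ⟨h1, h2⟩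
      · exact mk (Equiv.swap 0 1) (sub_eq_zero.mp h0).symm h1 h2
      · exact mk (finRotate 3) (sub_eq_zero.mp h0).symm h1 h2
  · rcases pair (d 0) (d 1) (d' 1) (d' 2) (by linear_combination s1 - h0)
      (by linear_combination s2 - (d' 1 + d' 2) * h0 - d 2 * (s1 - h0)) with ⟨h1, h2⟩ | ⟨h1, h2⟩
    · exact mk (finRotate 3).symm (sub_eq_zero.mp h0).symm h1 h2
    · exact mk (Equiv.swap 0 2) (sub_eq_zero.mp h0).symm h1 h2

theorem not_similar_diagonal_twoForm {S : Matrix (Fin 3) (Fin 3) ℂ} (hS : IsUnit S.det)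
    {d : Fin 3 → ℂ} {a b : ℂ} (h : S * Matrix.diagonal d = twoForm a b * S) : False := by
  rcases eq_or_ne a 0 with rfl | ha
  · rw [twoForm_zero] at h
    -- `M` projects onto the block of size two, where `twoForm - b • 1` is nonzero of square zero.
    refine not_similar_diagonal hS h (x := b) (M := !![1, 0, 0; 0, 1, 0; 0, 0, 0]) ?_ ?_
    · ext i j
      fin_cases i <;> fin_cases j <;>
        simp [pow_two, Matrix.mul_apply, Fin.sum_univ_three, Matrix.one_apply]
    · intro h0
      simpa [Matrix.mul_apply, Fin.sum_univ_three, Matrix.one_apply] using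
        congrFun (congrFun h0 0) 1
  · rw [twoForm_of_ne_zero ha] at h
    refine not_similar_diagonal hS h (x := b) (M := !![0, 0, 0; 0, 1, 0; 0, 0, 1]) ?_ ?_
    · ext i j
      fin_cases i <;> fin_cases j <;>
        simp [pow_two, Matrix.mul_apply, Fin.sum_univ_three, Matrix.one_apply]
    · intro h0
      simpa [Matrix.mul_apply, Fin.sum_univ_three, Matrix.one_apply] using
        congrFun (congrFun h0 1) 2

/-- One nonzero entry is enough to show that the nilpotent part has nonzero square, unlike that of
`twoForm a a`. -/
theorem threeForm_sub_sq_apply (a : ℂ) : ((threeForm a - a • 1) ^ 2 : Matrix (Fin 3) (Fin 3) ℂ) 0 2 = 2 := by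
  simp [threeForm, pow_two, Matrix.mul_apply, Fin.sum_univ_three, Matrix.one_apply]
  linear_combination -Complex.I_mul_I

theorem threeForm_sub_pow_three (a : ℂ) : (threeForm a - a • 1) ^ 3 = 0 := by
  have e : threeForm a - a • 1 =
      !![0, 1 + Complex.I, 0; 1 + Complex.I, 0, 1 - Complex.I; 0, 1 - Complex.I, 0] := by
    ext i j; fin_cases i <;> fin_cases j <;> simp [threeForm]
  have hI : (1 + Complex.I) * (1 + Complex.I) = -((1 - Complex.I) * (1 - Complex.I)) := by
    linear_combination 2 * Complex.I_mul_I
  rw [e, pow_three]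
  ext i j
  fin_cases i <;> fin_cases j <;> simp [Matrix.mul_apply, Fin.sum_univ_three]
  all_goals grind

theorem not_similar_diagonal_threeForm {S : Matrix (Fin 3) (Fin 3) ℂ} (hS : IsUnit S.det)
    {d : Fin 3 → ℂ} {a : ℂ} (h : S * Matrix.diagonal d = threeForm a * S) : False := by
  refine not_similar_diagonal hS h (x := a) (M := threeForm a - a • 1) ?_ ?_
  · rw [← pow_succ, threeForm_sub_pow_three]
  · intro h0
    have := threeForm_sub_sq_apply a
    rw [pow_two, h0] at this
    simp at this

/-- If the double roots differed, each would be the simple root on the other side; the equality of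
root sums then forces `b = b'`. -/
theorem eq_of_sub_mul_sub_sq_eq {a b a' b' : ℂ}
    (h : ∀ x, (a - x) * (b - x) ^ 2 = (a' - x) * (b' - x) ^ 2) : a = a' ∧ b = b' := by
  have s : a + 2 * b = a' + 2 * b' := by
    linear_combination (h 1 + h (-1)) / 2 - h 0
  have hb : b = b' := by
    by_contra hb
    have h1 : (a' - b) * (b' - b) ^ 2 = 0 := by rw [← h]; ring
    have h2 : (a - b') * (b - b') ^ 2 = 0 := by rw [h]; ring
    have hb1 : (b' - b) ^ 2 ≠ 0 := pow_ne_zero _ (sub_ne_zero.mpr (Ne.symm hb))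
    have hb2 : (b - b') ^ 2 ≠ 0 := pow_ne_zero _ (sub_ne_zero.mpr hb)
    have h1 := (mul_eq_zero.mp h1).resolve_right hb1
    have h2 := (mul_eq_zero.mp h2).resolve_right hb2
    exact hb (by linear_combination s + h1 - h2)
  exact ⟨by linear_combination s - 2 * hb, hb⟩

theorem twoForm_self_sub_sq (a : ℂ) : (twoForm a a - a • 1) ^ 2 = 0 := by
  rcases eq_or_ne a 0 with rfl | ha
  · rw [twoForm_zero]
    ext i j
    fin_cases i <;> fin_cases j <;> simp [pow_two, Matrix.mul_apply, Fin.sum_univ_three]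
  · rw [twoForm_of_ne_zero ha]
    ext i j
    fin_cases i <;> fin_cases j <;>
      simp [pow_two, Matrix.mul_apply, Fin.sum_univ_three, Matrix.one_apply]

theorem not_similar_twoForm_threeForm {S : Matrix (Fin 3) (Fin 3) ℂ} (hS : IsUnit S.det)
    {a b c : ℂ} (h : S * twoForm a b = threeForm c * S) : False := by
  obtain ⟨rfl, rfl⟩ := eq_of_sub_mul_sub_sq_eq (a := a) (b := b) (a' := c) (b' := c) fun x => by
    rw [← det_twoForm_sub, Matrix.det_sub_smul_one_eq hS h, det_threeForm_sub]; ring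
  have h2 := Matrix.mul_sq_sub_smul_one_eq h b
  rw [twoForm_self_sub_sq, mul_zero] at h2
  have h3 : (threeForm b - b • 1) ^ 2 = 0 := by
    have := congrArg (· * S⁻¹) h2
    simpa [mul_assoc, Matrix.mul_nonsing_inv _ hS] using this.symm
  have := threeForm_sub_sq_apply b
  rw [h3] at this
  simp at this

theorem eqUpToDiagonalOrder_of_similar {r r' : ℕ} {P Q S : Matrix (Fin 3) (Fin 3) ℂ}
    (hP : IsNormalForm3 r P) (hQ : IsNormalForm3 r' Q) (hS : IsUnit S.det) (h : S * P = Q * S) :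
    EqUpToDiagonalOrder P Q := by
  have hS' : IsUnit (S⁻¹).det := Matrix.isUnit_nonsing_inv_det _ hS
  have h' : S⁻¹ * Q = P * S⁻¹ := by
    calc S⁻¹ * Q = S⁻¹ * (Q * S) * S⁻¹ := by
          rw [mul_assoc, mul_assoc, Matrix.mul_nonsing_inv _ hS, mul_one]
      _ = P * S⁻¹ := by rw [← h, ← mul_assoc, Matrix.nonsing_inv_mul _ hS, one_mul]
  have hdet := Matrix.det_sub_smul_one_eq hS h
  rcases hP.cases_form with ⟨d, rfl⟩ | ⟨a, b, rfl⟩ | ⟨a, rfl⟩ <;>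
    rcases hQ.cases_form with ⟨d', rfl⟩ | ⟨a', b', rfl⟩ | ⟨a', rfl⟩
  · obtain ⟨σ, rfl⟩ := exists_perm_of_prod_sub_eq (d := d) (d' := d') fun x => by
      rw [← det_diagonal_sub, hdet, det_diagonal_sub]
    exact .inr ⟨d, σ, rfl, rfl⟩
  · exact (not_similar_diagonal_twoForm hS h).elim
  · exact (not_similar_diagonal_threeForm hS h).elim
  · exact (not_similar_diagonal_twoForm hS' h').elim
  · obtain ⟨rfl, rfl⟩ := eq_of_sub_mul_sub_sq_eq (a := a) (b := b) (a' := a') (b' := b') fun x => by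
      rw [← det_twoForm_sub, hdet, det_twoForm_sub]
    exact .inl rfl
  · exact (not_similar_twoForm_threeForm hS h).elim
  · exact (not_similar_diagonal_threeForm hS' h').elim
  · exact (not_similar_twoForm_threeForm hS' h').elim
  · obtain ⟨rfl, -⟩ := eq_of_sub_mul_sub_sq_eq (a := a) (b := a) (a' := a') (b' := a') fun x => by
      have := hdet x
      rw [det_threeForm_sub, det_threeForm_sub] at this
      linear_combination this
    exact .inl rfl

theorem Matrix.mul_eq_mul_of_eq_conj {n : Type*} [Fintype n] [DecidableEq n] {A B T : Matrix n n ℂ}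
    (hT : T ∈ Matrix.orthogonalGroup n ℂ) (h : T * A * T⁻¹ = B) :
    IsUnit T.det ∧ T * A = B * T := by
  have hu : IsUnit T.det :=
    Matrix.isUnit_det_of_left_inverse ((Matrix.mem_orthogonalGroup_iff' n ℂ).mp hT)
  exact ⟨hu, by rw [← h, mul_assoc, Matrix.nonsing_inv_mul _ hu, mul_one]⟩

theorem Matrix.rank_eq_of_mul_eq_mul {n : Type*} [Fintype n] [DecidableEq n] {A B S : Matrix n n ℂ}
    (hS : IsUnit S.det) (h : S * A = B * S) : A.rank = B.rank := by
  rw [← Matrix.rank_mul_eq_right_of_isUnit_det S A hS, h, Matrix.rank_mul_eq_left_of_isUnit_det S B hS]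

theorem mainTheorem6 :
    (∀ (n : ℕ) (A : Matrix (Fin n) (Fin n) ℂ), A.IsSymm →
      (∃ (t : ℕ) (l : Fin t → ℂ) (k : Fin t → ℕ), HasElementaryDivisors A l k) ∧
      ∀ (t : ℕ) (l : Fin t → ℂ) (k : Fin t → ℕ), HasElementaryDivisors A l k →
        ∃ h : ∑ i, k i = n,
          (∃ T ∈ Matrix.orthogonalGroup (Fin n) ℂ, T * A * T⁻¹ = symNormalForm l k h) ∧
          (Odd n →
            ∃ T ∈ Matrix.specialOrthogonalGroup (Fin n) ℂ,
              T * A * T⁻¹ = symNormalForm l k h)) ∧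
    (∀ A : Matrix (Fin 3) (Fin 3) ℂ, A.IsSymm →
      ∃ P : Matrix (Fin 3) (Fin 3) ℂ,
        IsNormalForm3 A.rank P ∧
        (∃ T ∈ Matrix.specialOrthogonalGroup (Fin 3) ℂ, P = T * A * T⁻¹) ∧
        ∀ (r : ℕ) (Q : Matrix (Fin 3) (Fin 3) ℂ), IsNormalForm3 r Q →
          (∃ T ∈ Matrix.specialOrthogonalGroup (Fin 3) ℂ, Q = T * A * T⁻¹) →
          r = A.rank ∧ EqUpToDiagonalOrder P Q) := by

  refine ⟨fun n A hA => ⟨exists_hasElementaryDivisors A, fun t l k h => ?_⟩, fun A hA => ?_⟩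
  · obtain ⟨S, hS, hSA⟩ := h.exists_similar (finSigmaFinEquiv.trans (finCongr h.sum_eq))
    have hT := hA.exists_orthogonal_conj (symNormalForm_isSymm l k h.sum_eq) hS hSA
    exact ⟨h.sum_eq, hT, fun hn =>
      Matrix.exists_specialOrthogonal_conj (by rwa [Fintype.card_fin]) hT⟩
  · obtain ⟨r, P, hP, S, hS, hSA⟩ := exists_similar_isNormalForm3 A
    have hr : A.rank = r := (Matrix.rank_eq_of_mul_eq_mul hS hSA).trans hP.rank_eq
    obtain ⟨T, hT, hTA⟩ := Matrix.exists_specialOrthogonal_conj (by simp [Nat.odd_iff])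
      (hA.exists_orthogonal_conj hP.isSymm hS hSA)
    refine ⟨P, hr ▸ hP, ⟨T, hT, hTA.symm⟩, fun r' Q hQ ⟨R, hR, hRA⟩ => ?_⟩
    obtain ⟨hRu, hRA⟩ := Matrix.mul_eq_mul_of_eq_conj hR.1 hRA.symm
    refine ⟨hQ.rank_eq.symm.trans (Matrix.rank_eq_of_mul_eq_mul hRu hRA).symm,
      -- Uniqueness uses only that `P` and `Q` are similar through `A`, so `S` need not be
      -- orthogonal.
      eqUpToDiagonalOrder_of_similar hP hQ (S := R * S⁻¹) ?_ ?_⟩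
    · rw [Matrix.det_mul]
      exact hRu.mul (Matrix.isUnit_nonsing_inv_det _ hS)
    · have hP' : P = S * A * S⁻¹ := by
        rw [hSA, mul_assoc, Matrix.mul_nonsing_inv _ hS, mul_one]
      calc R * S⁻¹ * P = R * (S⁻¹ * S) * A * S⁻¹ := by rw [hP']; simp only [mul_assoc]
        _ = Q * (R * S⁻¹) := by
          rw [Matrix.nonsing_inv_mul _ hS, mul_one, hRA, mul_assoc]
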